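/- An arithmetic circuit is a finite directed acyclic graph with exactly one node of in-degree zero (the root) whose nodes are sum nodes with real-weighted edges to their children, product nodes with unweighted edges to their children, and leaves labelled by variables or real constants. Each node represents a polynomial with real coefficients: a leaf represents its label, a sum node the weighted sum and a product node the product of the polynomials represented by its children. The circuit computes the polynomial represented by its root, as an element of the polynomial ring, and its size is its number of edges. Let $\Pr$ be a probability distribution on $\{0,1\}^n$ and, for $S\subseteq[n]=\{1,\dots,n\}$, let $\mathbf{x}_S$ be the assignment with $X_i=1$ for $i\in S$ and $X_i=0$ for $i\notin S$. The likelihood polynomial of $\Pr$ is $$p(x_1,\dots,x_n)=\sum_{S\subseteq[n]}\Pr(\mathbf{x}_S)\prod_{i\in S}x_i\prod_{i\notin S}(1-x_i),$$ and the network polynomial of $\Pr$ is $$p(x_1,\dots,x_n,\bar x_1,\dots,\bar x_n)=\sum_{S\subseteq[n]}\Pr(\mathbf{x}_S)\prod_{i\in S}x_i\prod_{i\notin S}\bar x_i .$$ **Theorem.** There are an absolute constant $K$ and a transformation $T$ of circuits such that for every $n\ge 0$, every probability distribution $\Pr$ on $n$ binary variables, and every circuit $G$ of size $s$ in the variables $x_1,\dots,x_n$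 computing the likelihood polynomial of $\Pr$, the circuit $T(G)$ in the variables $x_1,\dots,x_n,\bar x_1,\dots,\bar x_n$ (without division nodes) computes the network polynomial of $\Pr$ and has size at most $K\cdot\max(s,1)\cdot n^2$. In particular, for $s\ge 1$ its size is $O(sn^2)$. -/

import Mathlib

open MvPolynomial

/-- A node of an arithmetic circuit with variables in `σ` on the vertex set `V`: a leaf (a variable
or a real constant), a sum node with a weighted edge to each of its children, or a product node.
In `sum S w` only the values of `w` on `S` matter. -/
inductive CircuitNode (σ : Type) (V : Type) : Type
  | var (i : σ)
  | const (c : ℝ)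
  | sum (S : Finset V) (w : V → ℝ)
  | prod (S : Finset V)

namespace CircuitNode

variable {σ V : Type}

/-- The heads of the edges that leave the node. -/
def children : CircuitNode σ V → Finset V
  | var _ => ∅
  | const _ => ∅
  | sum S _ => S
  | prod S => S

/-- The polynomial represented by a node, given those represented by its children. -/
noncomputable def eval : CircuitNode σ V → (V → MvPolynomial σ ℝ) → MvPolynomial σ ℝ
  | var i, _ => X i
  | const c, _ => C c
  | sum S w, p => ∑ u ∈ S, C (w u) * p u
  | prod S, p => ∏ u ∈ S, p u

theorem eval_congr (g : CircuitNode σ V) {p q : V → MvPolynomial σ ℝ}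
    (h : ∀ u ∈ g.children, p u = q u) : g.eval p = g.eval q := by
  cases g with
  | var i => rfl
  | const c => rfl
  | sum S w => exact Finset.sum_congr rfl fun u hu => by rw [h u hu]
  | prod S => exact Finset.prod_congr rfl h

end CircuitNode

/-- An arithmetic circuit over `ℝ` with variables in `σ`: a finite directed acyclic graph with
labelled nodes and exactly one node of in-degree zero, the root. (For a finite graph,
well-foundedness of the edge relation says precisely that there is no directed cycle.) -/
structure ArithmeticCircuit (σ : Type) : Type 1 where
  V : Type
  fintypeV : Fintype V
  node : V → CircuitNode σ V
  acyclic : WellFounded fun u v : V => u ∈ (node v).children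
  root : V
  inDegree_eq_zero_iff : ∀ v, (∀ u, v ∉ (node u).children) ↔ v = root

namespace ArithmeticCircuit

variable {σ : Type}

attribute [instance] ArithmeticCircuit.fintypeV

/-- The size of a circuit is its number of edges. -/
def size (G : ArithmeticCircuit σ) : ℕ := ∑ v : G.V, (G.node v).children.card

open Classical in
/-- The polynomial represented by a node of the circuit, by recursion along the edges
(`nodePoly_eq` is the recursion equation). -/
noncomputable def nodePoly (G : ArithmeticCircuit σ) : G.V → MvPolynomial σ ℝ :=
  G.acyclic.fix fun v rec =>
    (G.node v).eval fun u => if h : u ∈ (G.node v).children then rec u h else 0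

theorem nodePoly_eq (G : ArithmeticCircuit σ) (v : G.V) :
    G.nodePoly v = (G.node v).eval G.nodePoly := by
  unfold nodePoly
  rw [WellFounded.fix_eq]
  exact CircuitNode.eval_congr _ fun u hu => by simp [hu]

/-- The polynomial represented (computed) by the circuit is the one represented by its root. -/
noncomputable def poly (G : ArithmeticCircuit σ) : MvPolynomial σ ℝ := G.nodePoly G.root

end ArithmeticCircuit

/-- The assignment `x_S`, with `X_i = 1` (`true`) for `i ∈ S` and `X_i = 0` (`false`) for
`i ∉ S`. -/
def assignment {n : ℕ} (S : Finset (Fin n)) : Fin n → Bool := fun i => decide (i ∈ S)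

/-- The likelihood polynomial `∑_S Pr(x_S) ∏_{i ∈ S} x_i ∏_{i ∉ S} (1 - x_i)`. -/
noncomputable def likelihoodPoly {n : ℕ} (Pr : PMF (Fin n → Bool)) : MvPolynomial (Fin n) ℝ :=
  ∑ S : Finset (Fin n),
    C (Pr (assignment S)).toReal * (∏ i ∈ S, X i) * ∏ i ∈ Sᶜ, (1 - X i)

/-- The network polynomial `∑_S Pr(x_S) ∏_{i ∈ S} x_i ∏_{i ∉ S} x̄_i`, where the indeterminate
`x_i` is `X (Sum.inl i)` and the indeterminate `x̄_i` is `X (Sum.inr i)`. -/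
noncomputable def networkPoly {n : ℕ} (Pr : PMF (Fin n → Bool)) :
    MvPolynomial (Fin n ⊕ Fin n) ℝ :=
  ∑ S : Finset (Fin n),
    C (Pr (assignment S)).toReal * (∏ i ∈ S, X (Sum.inl i)) * ∏ i ∈ Sᶜ, X (Sum.inr i)

/-! The network polynomial is `∏ (x_i + x̄_i)` times the likelihood polynomial at `x_i / (x_i +
x̄_i)`. The divisions are removed as in Strassen's method: along the line `x_i ↦ λ x_i`, `x̄_i ↦ 1 +
λ (x̄_i - 1)` each denominator becomes `1 + λ (x_i + x̄_i - 1)`, a unit among power series in `λ`.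
The product is a polynomial in `λ` of degree at most `n` (`prod_mul_eval₂Hom_likelihoodPoly`,
`natDegree_networkPencil_le`), so its coefficients up to `n` suffice, and their sum is its value at
`λ = 1`. The circuit is run on series truncated at degree `n`; each edge costs at most one truncated
multiplication, `O(n²)` edges (`coeffsLE_eval₂Hom`). Edges are counted with `Derives`, and
`Straightline.exists_circuit` turns the outcome into a circuit. -/

/-! ### Straight-line programs and their circuits -/

namespace CircuitNode

variable {σ V : Type}

open Classical in
/-- The node with its edges restricted to the heads that satisfy `p`. -/
noncomputable def restrict (p : V → Prop) : CircuitNode σ V → CircuitNode σ {v // p v}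
  | var i => var i
  | const c => const c
  | sum S w => sum (S.subtype p) fun v => w v
  | prod S => prod (S.subtype p)

open Classical in
theorem children_restrict (p : V → Prop) (g : CircuitNode σ V) :
    (g.restrict p).children = g.children.subtype p := by
  cases g <;> simp [restrict, children] <;> rfl

theorem mem_children_restrict {p : V → Prop} {g : CircuitNode σ V} {v : {v // p v}} :
    v ∈ (g.restrict p).children ↔ v.1 ∈ g.children := by
  classical simp [children_restrict]

theorem card_children_restrict_le (p : V → Prop) (g : CircuitNode σ V) :
    (g.restrict p).children.card ≤ g.children.card := by
  classical
  rw [children_restrict, Finset.card_subtype]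
  exact Finset.card_filter_le _ _

theorem eval_restrict {p : V → Prop} {g : CircuitNode σ V} (h : ∀ u ∈ g.children, p u)
    (q : V → MvPolynomial σ ℝ) : ((g.restrict p).eval fun v => q v) = g.eval q := by
  classical
  cases g with
  | var i => rfl
  | const c => rfl
  | sum S w => exact Finset.sum_subtype_of_mem (fun u => C (w u) * q u) h
  | prod S => exact Finset.prod_subtype_of_mem q h

end CircuitNode

open Classical in
/-- `Straightline A m`: there is a straight-line program with at most `m` edges whose nodes
represent the polynomials in `A`, one node for each. -/
inductive Straightline {σ : Type} : Finset (MvPolynomial σ ℝ) → ℕ → Prop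
  | empty (m : ℕ) : Straightline ∅ m
  | insert {A : Finset (MvPolynomial σ ℝ)} {m k : ℕ} (h : Straightline A m)
      (g : CircuitNode σ (MvPolynomial σ ℝ)) (hg : g.children ⊆ A)
      (hk : m + g.children.card ≤ k) : Straightline (insert (g.eval id) A) k

namespace Straightline

variable {σ : Type} {A : Finset (MvPolynomial σ ℝ)} {m : ℕ}

theorem mono (h : Straightline A m) {k : ℕ} (hk : m ≤ k) : Straightline A k := by
  cases h with
  | empty => exact .empty k
  | insert h g hg hm => exact .insert h g hg (hm.trans hk)

theorem exists_node (h : Straightline A m) :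
    ∃ (node : MvPolynomial σ ℝ → CircuitNode σ (MvPolynomial σ ℝ))
      (rank : MvPolynomial σ ℝ → ℕ),
      (∀ f ∈ A, (node f).children ⊆ A ∧ (∀ u ∈ (node f).children, rank u < rank f) ∧
        (node f).eval id = f) ∧ ∑ f ∈ A, (node f).children.card ≤ m := by
  classical
  induction h with
  | empty m => exact ⟨fun _ => .const 0, fun _ => 0, by simp, by simp⟩
  | @insert A m k h g hg hk ih =>
    obtain ⟨node, rank, hnode, hcard⟩ := ih
    -- A polynomial already present keeps its old node: the new one might use polynomials built from
    -- it, which would break the ranking.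
    by_cases hmem : g.eval id ∈ A
    · exact ⟨node, rank, by simpa [Finset.insert_eq_of_mem hmem] using hnode,
        by rw [Finset.insert_eq_of_mem hmem]; omega⟩
    · have hne : ∀ f ∈ A, f ≠ g.eval id := fun f hf h => hmem (h ▸ hf)
      refine ⟨Function.update node (g.eval id) g,
        Function.update rank (g.eval id) (A.sup rank + 1), ?_, ?_⟩
      · intro f hf
        rcases Finset.mem_insert.1 hf with rfl | hf
        · refine ⟨?_, ?_, by simp⟩
          · simpa using hg.trans (Finset.subset_insert _ _)
          · intro u hu
            rw [Function.update_self] at hu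
            rw [Function.update_self, Function.update_of_ne (hne u (hg hu))]
            exact Nat.lt_succ_of_le (Finset.le_sup (f := rank) (hg hu))
        · obtain ⟨h1, h2, h3⟩ := hnode f hf
          rw [Function.update_of_ne (hne f hf), Function.update_of_ne (hne f hf)]
          refine ⟨h1.trans (Finset.subset_insert _ _), fun u hu => ?_, h3⟩
          rw [Function.update_of_ne (hne u (h1 hu))]
          exact h2 u hu
      · rw [Finset.sum_insert hmem, Function.update_self]
        have : ∑ f ∈ A, (Function.update node (g.eval id) g f).children.card =
            ∑ f ∈ A, (node f).children.card :=
          Finset.sum_congr rfl fun f hf => by rw [Function.update_of_ne (hne f hf)]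
        omega

/-- A polynomial on a straight-line program is computed by a circuit: keep the nodes that can be
reached from its node. -/
theorem exists_circuit (h : Straightline A m) {r : MvPolynomial σ ℝ} (hr : r ∈ A) :
    ∃ G : ArithmeticCircuit σ, G.poly = r ∧ G.size ≤ m := by
  classical
  obtain ⟨node, rank, hnode, hcard⟩ := h.exists_node
  let p : MvPolynomial σ ℝ → Prop :=
    Relation.ReflTransGen (fun f u => u ∈ (node f).children) r
  have hpA : ∀ f, p f → f ∈ A := by
    intro f hf
    induction hf with
    | refl => exact hr
    | tail _ hu ih => exact (hnode _ ih).1 hu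
  have hrank : ∀ f, p f → rank f ≤ rank r := by
    intro f hf
    induction hf with
    | refl => exact le_rfl
    | tail hf hu ih => exact ((hnode _ (hpA _ hf)).2.1 _ hu).le.trans ih
  have hmem : ∀ f, f ∈ A.filter p ↔ p f := by
    intro f
    simpa using hpA f
  let G : ArithmeticCircuit σ :=
    { V := {f // p f}
      fintypeV := Fintype.subtype (A.filter p) hmem
      node := fun v => (node v.1).restrict p
      acyclic := by
        refine Subrelation.wf (r := InvImage (· < ·) fun v : {f // p f} => rank v.1) ?_
          (InvImage.wf _ wellFounded_lt)
        intro u v huv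
        exact (hnode v.1 (hpA _ v.2)).2.1 _ (CircuitNode.mem_children_restrict.1 huv)
      root := ⟨r, .refl⟩
      inDegree_eq_zero_iff := by
        intro v
        constructor
        · intro hv
          rcases Relation.ReflTransGen.cases_tail v.2 with h | ⟨f, hf, hfv⟩
          · exact Subtype.ext h
          · exact absurd (CircuitNode.mem_children_restrict.2 hfv) (hv ⟨f, hf⟩)
        · rintro rfl u hu
          have h1 := (hnode u.1 (hpA _ u.2)).2.1 _ (CircuitNode.mem_children_restrict.1 hu)
          have h2 := hrank u.1 u.2
          exact absurd h1 (not_lt.2 h2) }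
  have hpoly : ∀ v : G.V, G.nodePoly v = v.1 := by
    intro v
    induction v using G.acyclic.induction with
    | _ v ih =>
      rw [G.nodePoly_eq, CircuitNode.eval_congr _ ih]
      refine (CircuitNode.eval_restrict (q := id) fun u hu => ?_).trans
        (hnode v.1 (hpA _ v.2)).2.2
      exact Relation.ReflTransGen.tail v.2 hu
  refine ⟨G, hpoly G.root, ?_⟩
  calc G.size ≤ ∑ v ∈ @Finset.univ G.V G.fintypeV, (node v.1).children.card :=
        Finset.sum_le_sum fun v _ => CircuitNode.card_children_restrict_le p _
    _ = ∑ f ∈ A.filter p, (node f).children.card :=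
        (Finset.sum_subtype (F := G.fintypeV) _ hmem fun f => (node f).children.card).symm
    _ ≤ ∑ f ∈ A, (node f).children.card :=
        Finset.sum_le_sum_of_subset (Finset.filter_subset _ _)
    _ ≤ m := hcard

end Straightline

/-! ### A calculus of edge costs -/

/-- `Derives A c F`: every straight-line program whose nodes represent all polynomials in `A` can
be extended by at most `c` edges to one that also represents all polynomials in `F`. -/
def Derives {σ : Type} (A : Set (MvPolynomial σ ℝ)) (c : ℕ) (F : Set (MvPolynomial σ ℝ)) : Prop :=
  ∀ (A' : Finset (MvPolynomial σ ℝ)) (m : ℕ), A ⊆ A' → Straightline A' m →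
    ∃ B : Finset (MvPolynomial σ ℝ), A' ⊆ B ∧ Straightline B (m + c) ∧ F ⊆ B

namespace Derives

variable {σ : Type} {A A' F F' : Set (MvPolynomial σ ℝ)} {c d : ℕ}

theorem of_subset (h : F ⊆ A) : Derives A 0 F :=
  fun A' _ hA hs => ⟨A', subset_rfl, hs, h.trans hA⟩

theorem mono (h : Derives A c F) (hA : A ⊆ A') (hc : c ≤ d) (hF : F' ⊆ F) : Derives A' d F' := by
  intro B m hB hs
  obtain ⟨B', h1, h2, h3⟩ := h B m (hA.trans hB) hs
  exact ⟨B', h1, h2.mono (by omega), hF.trans h3⟩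

theorem trans (h : Derives A c F) (h' : Derives (A ∪ F) d F') : Derives A (c + d) (F ∪ F') := by
  intro B m hB hs
  obtain ⟨B', h1, h2, h3⟩ := h B m hB hs
  obtain ⟨B'', h4, h5, h6⟩ := h' B' _ (Set.union_subset (hB.trans (mod_cast h1)) h3) h2
  exact ⟨B'', h1.trans h4, h5.mono (by omega), Set.union_subset (h3.trans (mod_cast h4)) h6⟩

theorem trans_right (h : Derives A c F) (h' : Derives (A ∪ F) d F') : Derives A (c + d) F' :=
  (h.trans h').mono subset_rfl le_rfl Set.subset_union_right

theorem biUnion {ι : Type*} (I : Finset ι) {c : ι → ℕ} {F : ι → Set (MvPolynomial σ ℝ)}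
    (h : ∀ i ∈ I, Derives A (c i) (F i)) : Derives A (∑ i ∈ I, c i) (⋃ i ∈ I, F i) := by
  classical
  induction I using Finset.induction_on with
  | empty => exact of_subset (by simp)
  | insert i I hi ih =>
    rw [Finset.sum_insert hi, Finset.set_biUnion_insert]
    exact (h i (by simp)).trans ((ih fun j hj => h j (by simp [hj])).mono
      Set.subset_union_left le_rfl subset_rfl)

theorem biUnion_const {ι : Type*} (I : Finset ι) {F : ι → Set (MvPolynomial σ ℝ)}
    (h : ∀ i ∈ I, Derives A c (F i)) : Derives A (I.card * c) (⋃ i ∈ I, F i) :=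
  (biUnion I h).mono subset_rfl (by simp) subset_rfl

/-- Derivations along a well-founded relation on a finite type. -/
theorem iUnion_of_wellFounded {V : Type*} [Fintype V] {r : V → V → Prop} (hr : WellFounded r)
    {c : V → ℕ} {F : V → Set (MvPolynomial σ ℝ)}
    (h : ∀ v, Derives (A ∪ ⋃ u, ⋃ (_ : r u v), F u) (c v) (F v)) :
    Derives A (∑ v, c v) (⋃ v, F v) := by
  classical
  have key : ∀ k ≤ Fintype.card V, ∃ U : Finset V, U.card = k ∧
      Derives A (∑ v ∈ U, c v) (⋃ v ∈ U, F v) := by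
    intro k
    induction k with
    | zero => exact fun _ => ⟨∅, rfl, of_subset (by simp)⟩
    | succ k ih =>
      intro hk
      obtain ⟨U, hU, hd⟩ := ih (by omega)
      have hne : ((U : Set V)ᶜ).Nonempty := by
        by_contra hcon
        rw [Set.not_nonempty_iff_eq_empty, Set.compl_empty_iff, Finset.coe_eq_univ] at hcon
        rw [hcon, Finset.card_univ] at hU
        omega
      -- Minimality outside `U` puts all predecessors of `v` into `U`, where they are already
      -- derived.
      obtain ⟨v, hv, hmin⟩ := hr.has_min _ hne
      have hv' : v ∉ U := by simpa using hv
      refine ⟨insert v U, by rw [Finset.card_insert_of_notMem hv', hU], ?_⟩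
      rw [Finset.sum_insert hv', Finset.set_biUnion_insert, add_comm, Set.union_comm]
      refine hd.trans ((h v).mono (Set.union_subset_union_right _ ?_) le_rfl subset_rfl)
      refine Set.iUnion₂_subset fun u hu => ?_
      have huU : u ∈ U := by
        by_contra hcon
        exact hmin u (by simpa using hcon) hu
      exact Set.subset_biUnion_of_mem (u := F) huU
  obtain ⟨U, hU, hd⟩ := key _ le_rfl
  rw [Finset.card_eq_iff_eq_univ] at hU
  subst hU
  simpa using hd

theorem exists_circuit {f : MvPolynomial σ ℝ} (h : Derives ∅ c {f}) :
    ∃ G : ArithmeticCircuit σ, G.poly = f ∧ G.size ≤ c := by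
  obtain ⟨B, -, hB, hf⟩ := h ∅ 0 (by simp) (.empty 0)
  simpa using hB.exists_circuit (r := f) (by simpa using hf)

theorem eval (g : CircuitNode σ (MvPolynomial σ ℝ)) (hg : ↑g.children ⊆ A) :
    Derives A g.children.card {g.eval id} := by
  classical
  intro A' m hA hs
  exact ⟨_, Finset.subset_insert _ _, .insert hs g (mod_cast hg.trans hA) le_rfl, by simp⟩

theorem X (i : σ) : Derives A 0 {X i} := eval (.var i) (by simp [CircuitNode.children])

theorem C (a : ℝ) : Derives A 0 {C a} := eval (.const a) (by simp [CircuitNode.children])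

/-- Children form a set, so indices with equal `f i` share one edge that carries the sum of their
weights. -/
theorem sum {ι : Type*} (I : Finset ι) (w : ι → ℝ) (f : ι → MvPolynomial σ ℝ)
    (hf : ∀ i ∈ I, f i ∈ A) : Derives A I.card {∑ i ∈ I, MvPolynomial.C (w i) * f i} := by
  classical
  have h := eval (A := A) (.sum (I.image f) fun g => ∑ i ∈ I with f i = g, w i)
    (by simpa [CircuitNode.children, Set.subset_def] using hf)
  refine h.mono subset_rfl Finset.card_image_le ?_
  rw [Set.singleton_subset_singleton, CircuitNode.eval,
    ← Finset.sum_fiberwise_of_maps_to (fun i hi => Finset.mem_image_of_mem f hi)]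
  refine Finset.sum_congr rfl fun g _ => ?_
  rw [map_sum, Finset.sum_mul]
  exact Finset.sum_congr rfl fun i hi => by rw [(Finset.mem_filter.1 hi).2, id]

theorem linear_comb {f g : MvPolynomial σ ℝ} (a b : ℝ) (hf : f ∈ A) (hg : g ∈ A) :
    Derives A 2 {MvPolynomial.C a * f + MvPolynomial.C b * g} := by
  simpa using sum (A := A) Finset.univ ![a, b] ![f, g] (by simp [Fin.forall_fin_two, hf, hg])

theorem mul_of_ne {f g : MvPolynomial σ ℝ} (hne : f ≠ g) (hf : f ∈ A) (hg : g ∈ A) :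
    Derives A 2 {f * g} := by
  classical
  have h := eval (A := A) (.prod {f, g})
    (by simp [CircuitNode.children, Set.insert_subset_iff, hf, hg])
  simpa [CircuitNode.children, CircuitNode.eval, Finset.card_pair hne, Finset.prod_pair hne]
    using h

/-- As a circuit has no multiple edges, a square is computed as `f * (f + 1) - f`. -/
theorem mul {f g : MvPolynomial σ ℝ} (hf : f ∈ A) (hg : g ∈ A) : Derives A 6 {f * g} := by
  by_cases hne : f = g
  · subst hne
    -- Three nodes with two edges each give the 6; the factors `f` and `f + 1` are distinct.
    have h1 : Derives A 2 {MvPolynomial.C 1 * f + MvPolynomial.C 1 * MvPolynomial.C 1} :=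
      ((C 1).trans_right (linear_comb 1 1 (by simp [hf]) (by simp))).mono subset_rfl le_rfl
        subset_rfl
    have h2 : Derives A 4 {f * (MvPolynomial.C 1 * f + MvPolynomial.C 1 * MvPolynomial.C 1)} :=
      h1.trans_right (mul_of_ne (by simp) (by simp [hf]) (by simp))
    refine (h2.trans_right (linear_comb (g := f) 1 (-1) (Or.inr rfl) (Or.inl hf))).mono
      subset_rfl le_rfl ?_
    rw [Set.singleton_subset_singleton]
    simp only [map_neg, map_one]
    ring
  · exact (mul_of_ne hne hf hg).mono subset_rfl (by norm_num) subset_rfl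

end Derives

/-! ### Arithmetic of truncated power series -/

section PowerSeries

variable {σ : Type} {A : Set (MvPolynomial σ ℝ)} {N : ℕ}

/-- The coefficients of degree at most `N` of a power series. -/
def coeffsLE (N : ℕ) (f : PowerSeries (MvPolynomial σ ℝ)) : Set (MvPolynomial σ ℝ) :=
  ⋃ k ∈ Finset.range (N + 1), {PowerSeries.coeff k f}

theorem coeff_mem_coeffsLE {k : ℕ} (hk : k ≤ N) (f : PowerSeries (MvPolynomial σ ℝ)) :
    PowerSeries.coeff k f ∈ coeffsLE N f :=
  Set.mem_biUnion (Finset.mem_coe.2 (Finset.mem_range.2 (Nat.lt_succ_of_le hk)))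
    (Set.mem_singleton _)

namespace Derives

theorem coeffsLE_of_forall {c : ℕ} {f : PowerSeries (MvPolynomial σ ℝ)}
    (h : ∀ k ≤ N, Derives A c {PowerSeries.coeff k f}) :
    Derives A ((N + 1) * c) (coeffsLE N f) := by
  have := biUnion_const (Finset.range (N + 1))
    fun k hk => h k (Nat.le_of_lt_succ (Finset.mem_range.1 hk))
  rwa [Finset.card_range] at this

theorem coeffsLE_C (a : ℝ) :
    Derives A 0 (coeffsLE N (PowerSeries.C (MvPolynomial.C a : MvPolynomial σ ℝ))) := by
  refine (coeffsLE_of_forall (c := 0) fun k _ => ?_).mono subset_rfl (by simp) subset_rfl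
  rw [PowerSeries.coeff_C]
  split_ifs
  · exact C a
  · simpa using C (A := A) (0 : ℝ)

theorem coeffsLE_sum {ι : Type*} (I : Finset ι) (w : ι → ℝ)
    (f : ι → PowerSeries (MvPolynomial σ ℝ)) (hf : ∀ i ∈ I, coeffsLE N (f i) ⊆ A) :
    Derives A ((N + 1) * I.card)
      (coeffsLE N (∑ i ∈ I, PowerSeries.C (MvPolynomial.C (w i)) * f i)) := by
  refine coeffsLE_of_forall fun k hk => ?_
  simp only [map_sum, PowerSeries.coeff_C_mul]
  exact sum I w _ fun i hi => hf i hi (coeff_mem_coeffsLE hk _)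

/-- Each coefficient is a convolution of at most `N + 1` products, at 6 edges per product and one
more to add it up. -/
theorem coeffsLE_mul {f g : PowerSeries (MvPolynomial σ ℝ)} (hf : coeffsLE N f ⊆ A)
    (hg : coeffsLE N g ⊆ A) : Derives A (7 * (N + 1) ^ 2) (coeffsLE N (f * g)) := by
  refine (coeffsLE_of_forall (c := 7 * (N + 1)) fun k hk => ?_).mono subset_rfl
    (by rw [pow_two]; exact le_of_eq (by ring)) subset_rfl
  rw [PowerSeries.coeff_mul]
  have h1 := biUnion_const (A := A) (c := 6) (Finset.HasAntidiagonal.antidiagonal k)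
    (F := fun p => {PowerSeries.coeff p.1 f * PowerSeries.coeff p.2 g}) fun p hp => by
      rw [Finset.HasAntidiagonal.mem_antidiagonal] at hp
      exact mul (hf (coeff_mem_coeffsLE (by omega) _)) (hg (coeff_mem_coeffsLE (by omega) _))
  have h2 := h1.trans_right (sum (Finset.HasAntidiagonal.antidiagonal k) (fun _ => 1)
    (fun p => PowerSeries.coeff p.1 f * PowerSeries.coeff p.2 g) fun p hp =>
      Or.inr (Set.mem_biUnion (Finset.mem_coe.2 hp) (Set.mem_singleton _)))
  refine h2.mono subset_rfl ?_ (by simp)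
  rw [Finset.Nat.card_antidiagonal]
  omega

/-- Factors are multiplied in one at a time, starting from 1, so that a product node pays per edge.
-/
theorem coeffsLE_prod {ι : Type*} (I : Finset ι) (f : ι → PowerSeries (MvPolynomial σ ℝ))
    (hf : ∀ i ∈ I, coeffsLE N (f i) ⊆ A) :
    Derives A (I.card * (7 * (N + 1) ^ 2)) (coeffsLE N (∏ i ∈ I, f i)) := by
  classical
  induction I using Finset.induction_on with
  | empty => simpa using coeffsLE_C (A := A) (N := N) 1
  | insert i I hi ih =>
    rw [Finset.prod_insert hi, Finset.card_insert_of_notMem hi, add_mul, one_mul]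
    exact (ih fun j hj => hf j (by simp [hj])).trans_right (coeffsLE_mul
      ((hf i (by simp)).trans Set.subset_union_left) Set.subset_union_right)

/-- Multiplication by linear factors is cheaper than general multiplication. -/
theorem coeffsLE_prod_one_add_X_mul {ι : Type*} (I : Finset ι) (w : ι → MvPolynomial σ ℝ)
    (hw : ∀ i ∈ I, w i ∈ A) : Derives A (I.card * ((N + 1) * 8))
      (coeffsLE N (∏ i ∈ I, (1 + PowerSeries.X * PowerSeries.C (w i)))) := by
  classical
  induction I using Finset.induction_on with
  | empty => simpa using coeffsLE_C (A := A) (N := N) 1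
  | insert i I hi ih =>
    rw [Finset.prod_insert hi, Finset.card_insert_of_notMem hi, add_mul, one_mul]
    -- A new coefficient is `coeff (k + 1) f + w i * coeff k f`: 6 edges for the product, 2 for the
    -- sum.
    refine (ih fun j hj => hw j (by simp [hj])).trans_right (coeffsLE_of_forall fun k hk => ?_)
    set f := ∏ j ∈ I, (1 + PowerSeries.X * PowerSeries.C (w j))
    rw [add_mul, one_mul, mul_assoc, map_add]
    cases k with
    | zero =>
      rw [PowerSeries.coeff_zero_X_mul, add_zero]
      refine (of_subset ?_).mono subset_rfl (Nat.zero_le _) subset_rfl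
      exact Set.singleton_subset_iff.2 (Or.inr (coeff_mem_coeffsLE hk f))
    | succ k =>
      rw [PowerSeries.coeff_succ_X_mul, PowerSeries.coeff_C_mul]
      have h1 := mul (A := A ∪ coeffsLE N f) (Or.inl (hw i (by simp)))
        (Or.inr (coeff_mem_coeffsLE (by omega : k ≤ N) f))
      refine (h1.trans_right (linear_comb (f := PowerSeries.coeff (k + 1) f) 1 1
        (Or.inl (Or.inr (coeff_mem_coeffsLE hk f))) (Or.inr rfl))).mono subset_rfl le_rfl ?_
      simp

/-- Evaluation of a circuit in power series, truncated at degree `N`. -/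
theorem coeffsLE_eval₂Hom {τ : Type} (G : ArithmeticCircuit τ)
    (y : τ → PowerSeries (MvPolynomial σ ℝ)) (hy : ∀ i, coeffsLE N (y i) ⊆ A) :
    Derives A (G.size * (7 * (N + 1) ^ 2))
      (coeffsLE N (eval₂Hom (PowerSeries.C.comp MvPolynomial.C) y G.poly)) := by
  set Φ := eval₂Hom (PowerSeries.C.comp MvPolynomial.C) y
  have key := iUnion_of_wellFounded (A := A) G.acyclic
    (c := fun v => (G.node v).children.card * (7 * (N + 1) ^ 2))
    (F := fun v => coeffsLE N (Φ (G.nodePoly v))) fun v => by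
      have hsub : ∀ u ∈ (G.node v).children, coeffsLE N (Φ (G.nodePoly u)) ⊆
          A ∪ ⋃ u, ⋃ (_ : u ∈ (G.node v).children), coeffsLE N (Φ (G.nodePoly u)) :=
        fun u hu => Set.subset_union_of_subset_right
          (Set.subset_iUnion₂ (s := fun u (_ : u ∈ (G.node v).children) =>
            coeffsLE N (Φ (G.nodePoly u))) u hu) _
      rw [G.nodePoly_eq v]
      generalize (⋃ u, ⋃ (_ : u ∈ (G.node v).children), coeffsLE N (Φ (G.nodePoly u))) = F at *
      cases hg : G.node v with
      | var i =>
        refine (of_subset (((hy i).trans Set.subset_union_left))).mono subset_rfl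
          (Nat.zero_le _) ?_
        simp [CircuitNode.eval, Φ]
      | const c =>
        refine (coeffsLE_C (N := N) (A := A ∪ F) c).mono subset_rfl (Nat.zero_le _) ?_
        simp [CircuitNode.eval, Φ]
      | sum S w =>
        rw [hg] at hsub
        refine (coeffsLE_sum S w (fun u => Φ (G.nodePoly u)) hsub).mono subset_rfl ?_ ?_
        · rw [mul_comm]
          exact Nat.mul_le_mul_left _ (by nlinarith)
        · simp [CircuitNode.eval, Φ]
      | prod S =>
        rw [hg] at hsub
        refine (coeffsLE_prod S (fun u => Φ (G.nodePoly u)) hsub).mono subset_rfl le_rfl ?_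
        simp [CircuitNode.eval]
  refine key.mono subset_rfl ?_ (Set.subset_iUnion_of_subset G.root subset_rfl)
  rw [← Finset.sum_mul]
  exact le_rfl

/-- The truncation of the power series `x λ / (1 + w λ)`. -/
theorem coeffsLE_X_mul_geometric {x w : MvPolynomial σ ℝ} (hx : x ∈ A) (hw : w ∈ A) :
    Derives A ((N + 1) * 8)
      (coeffsLE N (PowerSeries.X * PowerSeries.mk fun k => x * (-w) ^ k)) := by
  -- Each term is the previous one times `w`, followed by a change of sign: 6 + 1 edges, within the
  -- allowed 8.
  have h : ∀ M, Derives A (M * 8) (⋃ k ∈ Finset.range (M + 1), {x * (-w) ^ k}) := by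
    intro M
    induction M with
    | zero => exact (of_subset (by simpa using hx)).mono subset_rfl (by simp) subset_rfl
    | succ M ih =>
      have h0 : x * (-w) ^ M ∈ ⋃ k ∈ Finset.range (M + 1), ({x * (-w) ^ k} : Set _) :=
        Set.mem_biUnion (by simp) (Set.mem_singleton _)
      rw [Finset.range_add_one (n := M + 1), Finset.set_biUnion_insert, Set.union_comm, add_mul]
      refine ih.trans ?_
      have h1 := mul (A := A ∪ ⋃ k ∈ Finset.range (M + 1), {x * (-w) ^ k})
        (Or.inr h0) (Or.inl hw)
      refine (h1.trans_right (sum {()} (fun _ => -1) (fun _ => x * (-w) ^ M * w)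
        (by simp))).mono subset_rfl (by simp) ?_
      rw [Set.singleton_subset_singleton]
      simp only [map_neg, map_one, Finset.sum_singleton]
      ring
  refine ((h N).trans_right ((coeffsLE_of_forall (c := 0) fun k hk => ?_))).mono subset_rfl
    (by omega) subset_rfl
  cases k with
  | zero => simpa using C (0 : ℝ)
  | succ k =>
    refine of_subset ?_
    rw [PowerSeries.coeff_succ_X_mul, PowerSeries.coeff_mk, Set.singleton_subset_iff]
    exact Or.inr (Set.mem_biUnion (Finset.mem_coe.2 (Finset.mem_range.2 (by omega)))
      (Set.mem_singleton _))

end Derives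

/-- Multiplying the geometric series by `1 + w λ` telescopes. This replaces division. -/
theorem one_add_X_mul_C_mul_geometric (x w : MvPolynomial σ ℝ) :
    (1 + PowerSeries.X * PowerSeries.C w) *
      (PowerSeries.X * PowerSeries.mk fun k => x * (-w) ^ k) =
      PowerSeries.X * PowerSeries.C x := by
  have h : (1 + PowerSeries.X * PowerSeries.C w) * (PowerSeries.mk fun k => x * (-w) ^ k) =
      PowerSeries.C x := by
    ext1 k
    rw [add_mul, one_mul, mul_assoc, map_add, PowerSeries.coeff_C]
    cases k with
    | zero => simp
    | succ k =>
      rw [PowerSeries.coeff_succ_X_mul, PowerSeries.coeff_C_mul]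
      simp
      ring
  rw [mul_left_comm, h]

theorem sum_coeff_coe_eq_eval_one {q : Polynomial (MvPolynomial σ ℝ)} (hq : q.natDegree ≤ N) :
    ∑ k ∈ Finset.range (N + 1), PowerSeries.coeff k (q : PowerSeries (MvPolynomial σ ℝ)) =
      q.eval 1 := by
  simp [Polynomial.eval_eq_sum_range' (Nat.lt_succ_of_le hq)]

end PowerSeries

/-! ### From the likelihood polynomial to the network polynomial -/

variable {n : ℕ}

/-- `x_i + x̄_i - 1`. -/
noncomputable def pairShift (i : Fin n) : MvPolynomial (Fin n ⊕ Fin n) ℝ :=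
  X (Sum.inl i) + X (Sum.inr i) - 1

/-- The power series `x_i λ / (1 + (x_i + x̄_i - 1) λ)`. -/
noncomputable def ratioSeries (i : Fin n) : PowerSeries (MvPolynomial (Fin n ⊕ Fin n) ℝ) :=
  PowerSeries.X * PowerSeries.mk fun k => X (Sum.inl i) * (-pairShift i) ^ k

/-- The network polynomial with `x_i` replaced by `λ x_i` and `x̄_i` by `1 + λ (x̄_i - 1)`. -/
noncomputable def networkPencil (Pr : PMF (Fin n → Bool)) :
    Polynomial (MvPolynomial (Fin n ⊕ Fin n) ℝ) :=
  ∑ S : Finset (Fin n), Polynomial.C (C (Pr (assignment S)).toReal) *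
    (∏ i ∈ S, (Polynomial.X * Polynomial.C (X (Sum.inl i)))) *
    ∏ i ∈ Sᶜ, (1 + Polynomial.X * Polynomial.C (X (Sum.inr i) - 1))

theorem networkPencil_eval_one (Pr : PMF (Fin n → Bool)) :
    (networkPencil Pr).eval 1 = networkPoly Pr := by
  simp [networkPencil, networkPoly, Polynomial.eval_finsetSum, Polynomial.eval_prod]

/-- Every summand has one factor of degree at most 1 for each `i`. Hence truncation at degree `n`
loses nothing. -/
theorem natDegree_networkPencil_le (Pr : PMF (Fin n → Bool)) :
    (networkPencil Pr).natDegree ≤ n := by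
  refine Polynomial.natDegree_sum_le_of_forall_le _ _ fun S _ => ?_
  have h1 : (∏ i ∈ S, (Polynomial.X * Polynomial.C (X (Sum.inl i)) :
      Polynomial (MvPolynomial (Fin n ⊕ Fin n) ℝ))).natDegree ≤ S.card := by
    refine (Polynomial.natDegree_prod_le _ _).trans ?_
    refine (Finset.sum_le_card_nsmul S _ 1 fun i _ => ?_).trans (by rw [nsmul_one, Nat.cast_id])
    compute_degree
  have h2 : (∏ i ∈ Sᶜ, (1 + Polynomial.X * Polynomial.C (X (Sum.inr i) - 1) :
      Polynomial (MvPolynomial (Fin n ⊕ Fin n) ℝ))).natDegree ≤ Sᶜ.card := by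
    refine (Polynomial.natDegree_prod_le _ _).trans ?_
    refine (Finset.sum_le_card_nsmul Sᶜ _ 1 fun i _ => ?_).trans (by rw [nsmul_one, Nat.cast_id])
    compute_degree
  have h3 := Finset.card_add_card_compl S
  rw [Fintype.card_fin] at h3
  rw [mul_assoc]
  exact ((Polynomial.natDegree_C_mul_le _ _).trans Polynomial.natDegree_mul_le).trans (by omega)

/-- The network polynomial arises from the likelihood polynomial by multiplication with
`∏ (x_i + x̄_i)` and the substitution of `x_i / (x_i + x̄_i)`; here along a line. -/
theorem prod_mul_eval₂Hom_likelihoodPoly (Pr : PMF (Fin n → Bool)) :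
    (∏ i, (1 + PowerSeries.X * PowerSeries.C (pairShift i))) *
      eval₂Hom (PowerSeries.C.comp C) ratioSeries (likelihoodPoly Pr) =
      (networkPencil Pr : PowerSeries (MvPolynomial (Fin n ⊕ Fin n) ℝ)) := by
  have hx : ∀ i : Fin n, (1 + PowerSeries.X * PowerSeries.C (pairShift i)) * ratioSeries i =
      PowerSeries.X * PowerSeries.C (X (Sum.inl i)) := fun i => one_add_X_mul_C_mul_geometric _ _
  have hx' : ∀ i : Fin n, (1 + PowerSeries.X * PowerSeries.C (pairShift i)) *
      (1 - ratioSeries i) = 1 + PowerSeries.X * PowerSeries.C (X (Sum.inr i) - 1) := by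
    intro i
    rw [mul_sub, hx, mul_one, pairShift]
    simp only [map_add, map_sub]
    ring
  rw [← Polynomial.coeToPowerSeries.ringHom_apply]
  simp only [networkPencil, likelihoodPoly, map_sum, map_mul, map_prod, map_sub, map_add, map_one,
    Finset.mul_sum, Polynomial.coeToPowerSeries.ringHom_apply, Polynomial.coe_X,
    Polynomial.coe_C, coe_eval₂Hom, eval₂_C, eval₂_X, RingHom.comp_apply]
  refine Finset.sum_congr rfl fun S _ => ?_
  -- The `n` factors are split between `S` and `Sᶜ`, so that each clears exactly one denominator, by
  -- `hx` or by `hx'`.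
  rw [← Finset.prod_mul_prod_compl S fun i => 1 + PowerSeries.X * PowerSeries.C (pairShift i)]
  simp only [map_sub, map_one] at hx'
  rw [← Finset.prod_congr rfl fun i _ => hx i, ← Finset.prod_congr rfl fun i _ => hx' i,
    Finset.prod_mul_distrib, Finset.prod_mul_distrib]
  ring

theorem derives_pairShift (i : Fin n) :
    Derives ∅ 3 {X (Sum.inl i), pairShift i} := by
  have h0 : Derives ∅ 0 ({X (Sum.inl i)} ∪ ({X (Sum.inr i)} ∪ {C 1}) :
      Set (MvPolynomial (Fin n ⊕ Fin n) ℝ)) :=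
    (Derives.X _).trans ((Derives.X _).trans (Derives.C _))
  refine (h0.trans (Derives.sum Finset.univ ![1, 1, -1] ![X (Sum.inl i), X (Sum.inr i), C 1]
    ?_)).mono subset_rfl (by simp) ?_
  · intro j _
    fin_cases j <;> simp
  · simp [Fin.sum_univ_three, pairShift, Set.insert_subset_iff, sub_eq_add_neg]

/-- The result of multiplying `∏ (x_i + x̄_i)` with `p (x_i / (x_i + x̄_i))_i`, expanded around
`x_i = 0`, `x̄_i = 1` and truncated at total degree `n`. -/
noncomputable def homogenizedPoly (p : MvPolynomial (Fin n) ℝ) :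
    MvPolynomial (Fin n ⊕ Fin n) ℝ :=
  ∑ k ∈ Finset.range (n + 1), PowerSeries.coeff k
    ((∏ i, (1 + PowerSeries.X * PowerSeries.C (pairShift i))) *
      eval₂Hom (PowerSeries.C.comp C) ratioSeries p)

theorem homogenizedPoly_likelihoodPoly (Pr : PMF (Fin n → Bool)) :
    homogenizedPoly (likelihoodPoly Pr) = networkPoly Pr := by
  rw [homogenizedPoly, prod_mul_eval₂Hom_likelihoodPoly,
    sum_coeff_coe_eq_eval_one (natDegree_networkPencil_le Pr), networkPencil_eval_one]

theorem derives_homogenizedPoly (G : ArithmeticCircuit (Fin n)) :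
    Derives ∅ (7 * (n + 1) ^ 2 * G.size + 27 * (n + 1) ^ 2) {homogenizedPoly G.poly} := by
  have h1 : Derives ∅ (n * (3 + (n + 1) * 8)) (⋃ i ∈ (Finset.univ : Finset (Fin n)),
      ({X (Sum.inl i), pairShift i} ∪ coeffsLE n (ratioSeries i))) := by
    have h := Derives.biUnion_const (Finset.univ : Finset (Fin n)) fun i _ =>
      (derives_pairShift i).trans (Derives.coeffsLE_X_mul_geometric (N := n)
        (x := X (Sum.inl i)) (w := pairShift i) (by simp) (by simp))
    rwa [Finset.card_univ, Fintype.card_fin] at h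
  set F₁ : Set (MvPolynomial (Fin n ⊕ Fin n) ℝ) := ⋃ i ∈ (Finset.univ : Finset (Fin n)),
      ({X (Sum.inl i), pairShift i} ∪ coeffsLE n (ratioSeries i))
  have hF₁ : ∀ i, {X (Sum.inl i), pairShift i} ∪ coeffsLE n (ratioSeries i) ⊆ F₁ :=
    fun i => Set.subset_biUnion_of_mem
      (u := fun i => {X (Sum.inl i), pairShift i} ∪ coeffsLE n (ratioSeries i))
      (Finset.mem_coe.2 (Finset.mem_univ i))
  have h2 := Derives.coeffsLE_eval₂Hom (A := ∅ ∪ F₁) G ratioSeries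
    fun i => (Set.subset_union_right.trans (hF₁ i)).trans Set.subset_union_right
  have h3 := Derives.coeffsLE_prod_one_add_X_mul (A := ∅ ∪ F₁) (N := n) Finset.univ pairShift
    fun i _ => Or.inr (hF₁ i (by simp))
  have h4 := h1.trans_right (h2.trans (h3.mono Set.subset_union_left le_rfl subset_rfl))
  have h5 := h4.trans_right ((Derives.coeffsLE_mul
    (Set.subset_union_right.trans Set.subset_union_right)
    (Set.subset_union_left.trans Set.subset_union_right)).trans_right
      (Derives.sum (Finset.range (n + 1)) (fun _ => 1) _ fun k hk =>
        Or.inr (coeff_mem_coeffsLE (Nat.le_of_lt_succ (Finset.mem_range.1 hk)) _)))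
  refine h5.mono subset_rfl ?_ ?_
  -- Besides the term with `G.size`: `n (3 + 8 (n + 1))` for the input series, `8 n (n + 1)` for the
  -- product of denominators, `7 (n + 1)²` for the last multiplication and `n + 1` for the final
  -- sum.
  · simp only [Finset.card_univ, Fintype.card_fin, Finset.card_range]
    nlinarith
  · simp only [map_one, one_mul]
    exact subset_rfl

/-- For `n = 0` the size bound is 0, so the circuit has to be a single leaf. -/
theorem homogenizedPoly_eq_C (p : MvPolynomial (Fin 0) ℝ) :
    homogenizedPoly p = C (constantCoeff p) := by
  conv_lhs => rw [eq_C_of_isEmpty p]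
  simp [homogenizedPoly, constantCoeff_eq]

theorem exists_circuit_homogenizedPoly (G : ArithmeticCircuit (Fin n)) :
    ∃ G' : ArithmeticCircuit (Fin n ⊕ Fin n),
      G'.poly = homogenizedPoly G.poly ∧ G'.size ≤ 136 * max G.size 1 * n ^ 2 := by
  rcases Nat.eq_zero_or_pos n with rfl | hn
  · rw [homogenizedPoly_eq_C]
    simpa using (Derives.C (A := ∅) (constantCoeff G.poly)).exists_circuit
  · obtain ⟨G', h1, h2⟩ := (derives_homogenizedPoly G).exists_circuit
    refine ⟨G', h1, h2.trans ?_⟩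
    -- This needs `n ≥ 1`; with `7 + 27 = 34` it gives `136 = 34 * 4`.
    have h3 : (n + 1) ^ 2 ≤ 4 * n ^ 2 := by nlinarith
    calc 7 * (n + 1) ^ 2 * G.size + 27 * (n + 1) ^ 2
        ≤ 7 * (n + 1) ^ 2 * max G.size 1 + 27 * (n + 1) ^ 2 * max G.size 1 :=
          add_le_add (Nat.mul_le_mul_left _ (le_max_left _ _))
            (Nat.le_mul_of_pos_right _ (by omega))
      _ = 34 * max G.size 1 * (n + 1) ^ 2 := by ring
      _ ≤ 34 * max G.size 1 * (4 * n ^ 2) := Nat.mul_le_mul_left _ h3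
      _ = 136 * max G.size 1 * n ^ 2 := by ring

theorem mainTheorem2 :
    ∃ (K : ℕ)
      (T : (n : ℕ) → ArithmeticCircuit (Fin n) → ArithmeticCircuit (Fin n ⊕ Fin n)),
      ∀ (n : ℕ) (Pr : PMF (Fin n → Bool)) (G : ArithmeticCircuit (Fin n)),
        G.poly = likelihoodPoly Pr →
          (T n G).poly = networkPoly Pr ∧ (T n G).size ≤ K * max G.size 1 * n ^ 2 := by
  -- `homogenizedPoly G.poly` makes sense for every circuit `G`, so `T` is chosen without reference
  -- to `Pr`.
  choose T hT using fun n => exists_circuit_homogenizedPoly (n := n)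
  refine ⟨136, T, fun n Pr G hG => ⟨?_, (hT n G).2⟩⟩
  rw [(hT n G).1, hG, homogenizedPoly_likelihoodPoly]
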